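/- Let $n,m\in\mathbb N$, let $a\in C^1(\mathbb R^n,\mathbb R^n)$ and $b\in C^1(\mathbb R^n,\mathbb R^{n\times m})$ satisfy $|a(x)|+|b(x)|\le K(1+|x|)$ for all $x\in\mathbb R^n$ and some constant $K\ge 0$. Let $R\in\mathbb R^{m\times m}$ be symmetric positive definite, and let $\ell_1:(0,\infty)\times\mathbb R^n\to[0,+\infty]$ be a normal integrand, i.e. measurable with respect to the product of the Lebesgue $\sigma$-algebra on $(0,\infty)$ and the Borel $\sigma$-algebra on $\mathbb R^n$, with $\ell_1(t,\cdot)$ lower semicontinuous for almost every $t>0$. (The value $+\infty$ allows state constraints to be encoded in $\ell_1$.) Put $\ell(t,x,u)=\ell_1(t,x)+u^\top R u$. Let $\mathcal U=L^2((0,\infty),\mathbb R^m)$ and let $\mathcal X=W^{1,1}_{\rm loc}([0,\infty),\mathbb R^n)$ be the space of locally absolutely continuous functions on $[0,\infty)$. For $u\in\mathcal U$ and $x_0\in\mathbb R^n$ let $x^{u,x_0}$ be the maximal (Carathéodory) solution of $$x'(t)=a(x(t))+b(x(t))u(t),\qquad x(0)=x_0 .$$ For $T\in(0,\infty)$ let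 $\mathcal A_T$ be the set of $(u,x)\in\mathcal U\times\mathcal X$ with $u=0$ a.e. on $(T,\infty)$, $x=x^{u,x_0}$ on $[0,T]$, and $x(t)=x(T)e^{-(t-T)}$ for $t>T$; let $\mathcal A_\infty$ be the set of $(u,x)\in\mathcal U\times\mathcal X$ with $x=x^{u,x_0}$ on $[0,\infty)$. For $T\in(0,\infty]$ let $\mathcal F_T:\mathcal U\times\mathcal X\to[0,+\infty]$ be defined by $$\mathcal F_T(u,x)=\int_0^T \ell(t,x(t),u(t))\,dt\ \text{ if }(u,x)\in\mathcal A_T,\qquad \mathcal F_T(u,x)=+\infty\ \text{ otherwise}.$$ A control $u\in\mathcal U$ is called optimal for $\mathcal F_T$ if $\mathcal F_T(u,x)=\inf_{\mathcal U\times\mathcal X}\mathcal F_T$ for some $x\in\mathcal X$. Suppose that the state equation is dissipative with respect to $\ell$ with a coercive storage function: there is $S:\mathbb R^n\to[0,\infty)$ with bounded sublevel sets such that $$S(x^{u,x_0}(t))-S(x_0)\le\int_0^t \ell(s,x^{u,x_0}(s),u(s))\,ds\qquad\text{for all }u\in\mathcal U,\ x_0\in\mathbb R^n,\ t\in\mathrm{dom}(x^{u,x_0}).$$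 Then, for every $x_0\in\mathbb R^n$, at least one of the following holds: (A) $\mathcal F_\infty\equiv+\infty$ on $\mathcal U\times\mathcal X$; or (B) for every sequence $T_k>0$ with $T_k\to\infty$ and every sequence $(u_{T_k})$ in $\mathcal U$ such that $u_{T_k}$ is an optimal control for $\mathcal F_{T_k}$ for each $k$, there is a subsequence of $(u_{T_k})$ that converges weakly in $L^2((0,\infty),\mathbb R^m)$ to an optimal control for $\mathcal F_\infty$. -/

import Mathlib

open MeasureTheory Set Filter Topology
open scoped ENNReal Matrix

noncomputable section

namespace QuadReg

/-- The control space `L²((0,∞), ℝᵐ)`. -/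
abbrev Control (m : ℕ) : Type :=
  Lp (EuclideanSpace ℝ (Fin m)) 2 (volume.restrict (Ioi (0 : ℝ)))

/-- The state space `W^{1,1}_loc([0,∞), ℝⁿ)`, i.e. the locally absolutely continuous functions on
`[0,∞)`. (Elements are total functions on `ℝ`; only their values on `[0,∞)` are ever used.) -/
abbrev State (n : ℕ) : Type :=
  {x : ℝ → EuclideanSpace ℝ (Fin n) // ∀ T : ℝ, 0 ≤ T → AbsolutelyContinuousOnInterval x 0 T}

/-- `ℓ₁ : (0,∞) × ℝⁿ → [0,∞]` is a normal integrand: it is measurable for the product of the Lebesgue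
σ-algebra on `(0,∞)` and the Borel σ-algebra on `ℝⁿ`, and `ℓ₁(t,·)` is lower semicontinuous for
almost all `t > 0`. -/
structure IsNormalIntegrand {n : ℕ} (ℓ₁ : ℝ → EuclideanSpace ℝ (Fin n) → ℝ≥0∞) : Prop where
  measurable :
    Measurable
      (fun p : NullMeasurableSpace ℝ (volume.restrict (Ioi (0 : ℝ))) × EuclideanSpace ℝ (Fin n) =>
        ℓ₁ p.1 p.2)
  lowerSemicontinuous :
    ∀ᵐ t ∂(volume.restrict (Ioi (0 : ℝ))), LowerSemicontinuous (ℓ₁ t)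

/-- The running cost `ℓ₁(t,x) + uᵀ R u`. -/
def runningCost {n m : ℕ} (ℓ₁ : ℝ → EuclideanSpace ℝ (Fin n) → ℝ≥0∞)
    (R : Matrix (Fin m) (Fin m) ℝ)
    (t : ℝ) (x : EuclideanSpace ℝ (Fin n)) (u : EuclideanSpace ℝ (Fin m)) : ℝ≥0∞ :=
  ℓ₁ t x + ENNReal.ofReal (u.ofLp ⬝ᵥ (R *ᵥ u.ofLp))

/-- `x` is, on `[0,T]`, the (absolutely continuous, Carathéodory) solution of
`x' = a(x) + b(x) u`, `x(0) = x₀`; that is, `T` lies in the domain of the maximal solution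
`x^{u,x₀}`, and `x = x^{u,x₀}` on `[0,T]`. -/
structure IsSolutionOn {n m : ℕ}
    (a : EuclideanSpace ℝ (Fin n) → EuclideanSpace ℝ (Fin n))
    (b : EuclideanSpace ℝ (Fin n) → EuclideanSpace ℝ (Fin m) →L[ℝ] EuclideanSpace ℝ (Fin n))
    (x₀ : EuclideanSpace ℝ (Fin n)) (u : Control m)
    (x : ℝ → EuclideanSpace ℝ (Fin n)) (T : ℝ) : Prop where
  absolutelyContinuous : AbsolutelyContinuousOnInterval x 0 T
  initial : x 0 = x₀
  hasDerivAt : ∀ᵐ t ∂(volume.restrict (Ioo 0 T)), HasDerivAt x (a (x t) + b (x t) (u t)) t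

/-- `S ≥ 0` is a storage function for `x' = a(x) + b(x) u` with supply function `r ≥ 0`. -/
structure IsStorageFunction {n m : ℕ}
    (a : EuclideanSpace ℝ (Fin n) → EuclideanSpace ℝ (Fin n))
    (b : EuclideanSpace ℝ (Fin n) → EuclideanSpace ℝ (Fin m) →L[ℝ] EuclideanSpace ℝ (Fin n))
    (r : ℝ → EuclideanSpace ℝ (Fin n) → EuclideanSpace ℝ (Fin m) → ℝ≥0∞)
    (S : EuclideanSpace ℝ (Fin n) → ℝ) : Prop where
  nonneg : ∀ x, 0 ≤ S x
  dissipation :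
    ∀ (u : Control m) (x₀ : EuclideanSpace ℝ (Fin n)) (x : ℝ → EuclideanSpace ℝ (Fin n)) (t : ℝ),
      0 ≤ t → IsSolutionOn a b x₀ u x t →
        ((S (x t) - S x₀ : ℝ) : EReal) ≤ ((∫⁻ s in Ioo 0 t, r s (x s) (u s) : ℝ≥0∞) : EReal)

/-- A function is coercive if all of its sublevel sets are bounded. -/
def Coercive {n : ℕ} (S : EuclideanSpace ℝ (Fin n) → ℝ) : Prop :=
  ∀ c : ℝ, Bornology.IsBounded {x | S x ≤ c}

/-- The admissible set `𝒜_T` for a finite horizon `T`: on `[0,T]` the state solves the Cauchy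
problem, and after `T` the control vanishes and the state decays exponentially. -/
def admissibleFin {n m : ℕ}
    (a : EuclideanSpace ℝ (Fin n) → EuclideanSpace ℝ (Fin n))
    (b : EuclideanSpace ℝ (Fin n) → EuclideanSpace ℝ (Fin m) →L[ℝ] EuclideanSpace ℝ (Fin n))
    (x₀ : EuclideanSpace ℝ (Fin n)) (T : ℝ) : Set (Control m × State n) :=
  {p | (∀ᵐ t ∂(volume.restrict (Ioi T)), p.1 t = 0) ∧
    IsSolutionOn a b x₀ p.1 p.2.1 T ∧
    ∀ t, T < t → p.2.1 t = Real.exp (-(t - T)) • p.2.1 T}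

/-- The admissible set `𝒜_∞`. -/
def admissibleInf {n m : ℕ}
    (a : EuclideanSpace ℝ (Fin n) → EuclideanSpace ℝ (Fin n))
    (b : EuclideanSpace ℝ (Fin n) → EuclideanSpace ℝ (Fin m) →L[ℝ] EuclideanSpace ℝ (Fin n))
    (x₀ : EuclideanSpace ℝ (Fin n)) : Set (Control m × State n) :=
  {p | ∀ T : ℝ, 0 ≤ T → IsSolutionOn a b x₀ p.1 p.2.1 T}

/-- The joint functional `∫_I ℓ(t, x(t), u(t)) dt + χ_𝒜(u, x)`, where `χ_𝒜` is `0` on `𝒜` and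
`+∞` off `𝒜`. -/
def jointFunctional {n m : ℕ}
    (ℓ : ℝ → EuclideanSpace ℝ (Fin n) → EuclideanSpace ℝ (Fin m) → ℝ≥0∞)
    (I : Set ℝ) (A : Set (Control m × State n)) (p : Control m × State n) : ℝ≥0∞ :=
  (∫⁻ t in I, ℓ t (p.2.1 t) (p.1 t)) + Aᶜ.indicator (fun _ => ⊤) p

/-- The regulator problem with finite horizon `T` and initial state `x₀`. -/
def regulatorFin {n m : ℕ}
    (a : EuclideanSpace ℝ (Fin n) → EuclideanSpace ℝ (Fin n))
    (b : EuclideanSpace ℝ (Fin n) → EuclideanSpace ℝ (Fin m) →L[ℝ] EuclideanSpace ℝ (Fin n))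
    (ℓ₁ : ℝ → EuclideanSpace ℝ (Fin n) → ℝ≥0∞) (R : Matrix (Fin m) (Fin m) ℝ)
    (x₀ : EuclideanSpace ℝ (Fin n)) (T : ℝ) : Control m × State n → ℝ≥0∞ :=
  jointFunctional (runningCost ℓ₁ R) (Ioo 0 T) (admissibleFin a b x₀ T)

/-- The regulator problem with infinite horizon and initial state `x₀`. -/
def regulatorInf {n m : ℕ}
    (a : EuclideanSpace ℝ (Fin n) → EuclideanSpace ℝ (Fin n))
    (b : EuclideanSpace ℝ (Fin n) → EuclideanSpace ℝ (Fin m) →L[ℝ] EuclideanSpace ℝ (Fin n))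
    (ℓ₁ : ℝ → EuclideanSpace ℝ (Fin n) → ℝ≥0∞) (R : Matrix (Fin m) (Fin m) ℝ)
    (x₀ : EuclideanSpace ℝ (Fin n)) : Control m × State n → ℝ≥0∞ :=
  jointFunctional (runningCost ℓ₁ R) (Ioi 0) (admissibleInf a b x₀)

/-- `u` is an optimal control for `F` if `(u, x)` is a minimizer of `F` for some state `x`. -/
def IsOptimalControl {n m : ℕ} (F : Control m × State n → ℝ≥0∞) (u : Control m) : Prop :=
  ∃ x : State n, F (u, x) = ⨅ p, F p

end QuadReg

end

/-! This is the direct method. If (A) fails, V = inf F_∞ is finite. Stopping an infinite-horizon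
competitor at time T costs no more than the competitor, so inf F_T ≤ V (`iInf_regulatorFin_le`), and
every optimal pair for F_{T_k} costs at most V. Positive definiteness of R then bounds the controls
in L², while dissipation gives S(x_k(t)) ≤ S(x₀) + V, so coercivity bounds the trajectories
uniformly in k and in t ∈ [0, T_k].

Bounded controls have a weakly convergent subsequence, and the trajectories are equicontinuous, so a
further subsequence converges pointwise. The dynamics are affine in u: b(x_k) converges strongly
against test vectors and u_k weakly, so the integral equation passes to the limit
(`exists_subseq_tendsto_isSolutionOn`).

Fatou's lemma with lower semicontinuity of ℓ₁ handles the state cost, and weak lower semicontinuity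
of the quadratic form the control cost. The limit pair therefore has F_∞ ≤ V and is a minimizer. -/

namespace AbsolutelyContinuousOnInterval

/-- A function whose increments are dominated by those of an absolutely continuous function is
absolutely continuous. -/
theorem of_dist_le {X Y : Type*} [PseudoMetricSpace X] [PseudoMetricSpace Y] {f : ℝ → X}
    {h : ℝ → Y} {a b : ℝ} (hh : AbsolutelyContinuousOnInterval h a b)
    (hfh : ∀ s ∈ uIcc a b, ∀ t ∈ uIcc a b, dist (f s) (f t) ≤ dist (h s) (h t)) :
    AbsolutelyContinuousOnInterval f a b := by
  rw [absolutelyContinuousOnInterval_iff] at hh ⊢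
  intro ε hε
  obtain ⟨δ, hδ, H⟩ := hh ε hε
  refine ⟨δ, hδ, fun E hE hEδ => lt_of_le_of_lt (Finset.sum_le_sum fun i hi => ?_) (H E hE hEδ)⟩
  exact hfh _ (hE.1 i hi).1 _ (hE.1 i hi).2

/-- Monotonicity keeps disjoint intervals disjoint, and the 1-Lipschitz bound keeps their total
length below δ. Used for the clamps t ↦ min t T and t ↦ max t T. -/
theorem comp_monotone_lipschitz {X : Type*} [PseudoMetricSpace X] {f : ℝ → X} {φ : ℝ → ℝ}
    {a b c d : ℝ} (hf : AbsolutelyContinuousOnInterval f c d) (hφ : Monotone φ)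
    (hL : ∀ s t, dist (φ s) (φ t) ≤ dist s t) (hmaps : MapsTo φ (uIcc a b) (uIcc c d)) :
    AbsolutelyContinuousOnInterval (fun t => f (φ t)) a b := by
  rw [absolutelyContinuousOnInterval_iff] at hf ⊢
  intro ε hε
  obtain ⟨δ, hδ, H⟩ := hf ε hε
  refine ⟨δ, hδ, fun E hE hEδ => ?_⟩
  refine H (E.1, fun i => (φ (E.2 i).1, φ (E.2 i).2)) ⟨fun i hi => ?_, ?_⟩ ?_
  · exact ⟨hmaps (hE.1 i hi).1, hmaps (hE.1 i hi).2⟩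
  · intro i hi j hj hij
    have key := hE.2 hi hj hij
    simp only [Function.onFun, uIoc] at key ⊢
    rw [Set.Ioc_disjoint_Ioc] at key ⊢
    simp only [← hφ.map_min, ← hφ.map_max]
    exact hφ key
  · exact lt_of_le_of_lt (Finset.sum_le_sum fun i _ => hL _ _) hEδ

end AbsolutelyContinuousOnInterval

/-! ### Fundamental theorem of calculus for vector-valued absolutely continuous functions. -/

section FTC

variable {F : Type*} [NormedAddCommGroup F] [NormedSpace ℝ F]

theorem IntervalIntegrable.absolutelyContinuousOnInterval_integral {g : ℝ → F} {a b : ℝ}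
    (hg : IntervalIntegrable g volume a b) :
    AbsolutelyContinuousOnInterval (fun t => ∫ s in a..t, g s) a b := by
  refine (hg.norm.absolutelyContinuousOnInterval_intervalIntegral
    (c := a) left_mem_uIcc).of_dist_le fun s hs t ht => ?_
  have h1 : IntervalIntegrable g volume a s := hg.mono_set (uIcc_subset_uIcc_left hs)
  have h2 : IntervalIntegrable g volume a t := hg.mono_set (uIcc_subset_uIcc_left ht)
  rw [dist_eq_norm, dist_eq_norm, intervalIntegral.integral_interval_sub_left h1 h2,
    intervalIntegral.integral_interval_sub_left h1.norm h2.norm, Real.norm_eq_abs]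
  exact intervalIntegral.norm_integral_le_abs_integral_norm

/-- The difference of f and the primitive of g is absolutely continuous with zero derivative a.e.,
hence constant. -/
theorem AbsolutelyContinuousOnInterval.integral_eq_sub_of_hasDerivAt [CompleteSpace F]
    {f g : ℝ → F} {a b : ℝ} (hab : a ≤ b) (hf : AbsolutelyContinuousOnInterval f a b)
    (hfg : ∀ᵐ t ∂(volume.restrict (Ioo a b)), HasDerivAt f (g t) t)
    (hg : IntervalIntegrable g volume a b) : ∫ t in a..b, g t = f b - f a := by
  have hac : AbsolutelyContinuousOnInterval (fun t => f t - ∫ s in a..t, g s) a b :=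
    hf.fun_sub hg.absolutelyContinuousOnInterval_integral
  have h0 : ∀ᵐ t, t ∈ uIcc a b → HasDerivAt (fun t => f t - ∫ s in a..t, g s) 0 t := by
    rw [ae_restrict_iff' measurableSet_Ioo] at hfg
    have ha : ∀ᵐ t : ℝ, t ≠ a := by simp [ae_iff, measure_singleton]
    have hb : ∀ᵐ t : ℝ, t ≠ b := by simp [ae_iff, measure_singleton]
    filter_upwards [hfg, hg.ae_hasDerivAt_integral, ha, hb] with t h1 h2 h3 h4 ht
    have ht' := ht
    rw [uIcc_of_le hab] at ht'
    have := (h1 ⟨lt_of_le_of_ne ht'.1 h3.symm, lt_of_le_of_ne ht'.2 h4⟩).sub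
      (h2 ht a left_mem_uIcc)
    rw [sub_self] at this
    exact this
  obtain ⟨C, hC⟩ := hac.const_of_ae_hasDerivAt_zero h0
  have h1 := hC a left_mem_uIcc
  have h2 := hC b right_mem_uIcc
  simp only [intervalIntegral.integral_same, sub_zero] at h1
  rw [← h1] at h2
  rw [← sub_eq_zero] at h2 ⊢
  rw [← neg_eq_zero, ← h2]
  abel

end FTC

/-! ### Weak convergence in Hilbert spaces. -/

section Weak

variable {H : Type*} [NormedAddCommGroup H] [InnerProductSpace ℝ H]

theorem tendsto_toWeakSpace_iff_inner [CompleteSpace H] {ι : Type*} {l : Filter ι} {u : ι → H}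
    {x : H} : Tendsto (fun k => toWeakSpace ℝ H (u k)) l (𝓝 (toWeakSpace ℝ H x)) ↔
      ∀ y : H, Tendsto (fun k => inner ℝ y (u k)) l (𝓝 (inner ℝ y x)) := by
  have hinj : Function.Injective (topDualPairing ℝ H).flip := by
    intro p q hpq
    refine ext_inner_left ℝ fun y => ?_
    exact congrArg (fun f : StrongDual ℝ H →ₗ[ℝ] ℝ => f (InnerProductSpace.toDual ℝ H y)) hpq
  refine (WeakBilin.tendsto_iff_forall_eval_tendsto _ hinj).trans ⟨fun h y => ?_, fun h f => ?_⟩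
  · exact h (InnerProductSpace.toDual ℝ H y)
  · have := h ((InnerProductSpace.toDual ℝ H).symm f)
    simp only [InnerProductSpace.toDual_symm_apply] at this
    exact this

/-- Sequential Banach–Alaoglu in the dual, transported back by the Riesz isomorphism. -/
theorem exists_subseq_tendsto_inner [CompleteSpace H] [TopologicalSpace.SeparableSpace H]
    {u : ℕ → H} {C : ℝ} (hu : ∀ k, ‖u k‖ ≤ C) :
    ∃ (φ : ℕ → ℕ) (x : H), StrictMono φ ∧
      ∀ y : H, Tendsto (fun k => inner ℝ y (u (φ k))) atTop (𝓝 (inner ℝ y x)) := by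
  obtain ⟨f, -, φ, hφ, hf⟩ := WeakDual.isSeqCompact_closedBall ℝ H 0 C
    (x := fun k => StrongDual.toWeakDual (InnerProductSpace.toDual ℝ H (u k)))
    (fun k => by simpa using hu k)
  refine ⟨φ, (InnerProductSpace.toDual ℝ H).symm (WeakDual.toStrongDual f), hφ, fun y => ?_⟩
  have := (tendsto_iff_forall_eval_tendsto_topDualPairing.1 hf) y
  rw [← real_inner_comm, InnerProductSpace.toDual_symm_apply]
  refine this.congr fun k => ?_
  exact real_inner_comm _ _

/-- Weak sequential lower semicontinuity of a nonnegative quadratic form. -/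
theorem le_of_tendsto_inner_of_quadratic_le (A : H →L[ℝ] H) (hA : ∀ v, 0 ≤ inner ℝ v (A v))
    (hsymm : ∀ v w, inner ℝ v (A w) = inner ℝ (A v) w)
    {u : ℕ → H} {x : H} (hu : ∀ y : H, Tendsto (fun k => inner ℝ y (u k)) atTop (𝓝 (inner ℝ y x))) :
    ENNReal.ofReal (inner ℝ x (A x)) ≤
      liminf (fun k => ENNReal.ofReal (inner ℝ (u k) (A (u k)))) atTop := by
  -- The tangent at x is an affine minorant of the convex form v ↦ ⟨v, Av⟩, by expanding ⟨v - x, A(v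
  -- - x)⟩ ≥ 0; being affine, it passes to weak limits.
  have hlim : Tendsto (fun k => ENNReal.ofReal (2 * inner ℝ (A x) (u k) - inner ℝ x (A x))) atTop
      (𝓝 (ENNReal.ofReal (inner ℝ x (A x)))) := by
    refine (ENNReal.continuous_ofReal.tendsto _).comp ?_
    have := ((hu (A x)).const_mul 2).sub_const (inner ℝ x (A x))
    convert! this using 2
    rw [← hsymm]; ring
  rw [← hlim.liminf_eq]
  refine liminf_le_liminf (Eventually.of_forall fun k => ENNReal.ofReal_le_ofReal ?_)
  have := hA (u k - x)
  rw [map_sub, inner_sub_left, inner_sub_right, inner_sub_right, hsymm (u k) x,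
    hsymm x (u k)] at this
  have e : inner ℝ (A (u k)) x = inner ℝ (A x) (u k) := by rw [← hsymm, real_inner_comm]
  linarith

end Weak

theorem Matrix.PosDef.exists_pos_mul_sq_le {m : ℕ} {R : Matrix (Fin m) (Fin m) ℝ}
    (hR : R.PosDef) :
    ∃ c : ℝ, 0 < c ∧ ∀ v : EuclideanSpace ℝ (Fin m),
      c * ‖v‖ ^ 2 ≤ inner ℝ v (Matrix.toEuclideanCLM (𝕜 := ℝ) R v) := by
  have hpos : ∀ v : EuclideanSpace ℝ (Fin m), v ≠ 0 →
      0 < inner ℝ v (Matrix.toEuclideanCLM (𝕜 := ℝ) R v) := by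
    intro v hv
    rw [Matrix.inner_toEuclideanCLM]
    have := hR.dotProduct_mulVec_pos (x := v.ofLp) (by simpa using hv)
    simpa using this
  -- The sphere is empty when m = 0; otherwise c is the minimum of the form on it, and homogeneity
  -- does the rest.
  rcases (Metric.sphere (0 : EuclideanSpace ℝ (Fin m)) 1).eq_empty_or_nonempty with h | h
  · refine ⟨1, one_pos, fun v => ?_⟩
    have hv : v = 0 := by
      by_contra hv
      have : (‖v‖⁻¹ • v) ∈ Metric.sphere (0 : EuclideanSpace ℝ (Fin m)) 1 := by
        simp [norm_smul, hv]
      rw [h] at this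
      exact this
    simp [hv]
  · obtain ⟨w, hw, hmin⟩ := (isCompact_sphere (0 : EuclideanSpace ℝ (Fin m)) 1).exists_isMinOn h
      (f := fun v => inner ℝ v (Matrix.toEuclideanCLM (𝕜 := ℝ) R v))
      (Continuous.continuousOn (by fun_prop))
    have hw0 : w ≠ 0 := by
      rintro rfl
      simp at hw
    refine ⟨_, hpos w hw0, fun v => ?_⟩
    by_cases hv : v = 0
    · simp [hv]
    have hv' : 0 < ‖v‖ := norm_pos_iff.2 hv
    have := hmin (a := ‖v‖⁻¹ • v) (by simp [norm_smul, hv])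
    simp only [mem_ofPred_eq, map_smul, inner_smul_left, inner_smul_right] at this
    rw [← le_div_iff₀ (by positivity)]
    refine this.trans (le_of_eq ?_)
    simp
    field_simp

/-! ### The control cost as a quadratic form on L². -/

namespace QuadReg

/-- Pointwise multiplication of a control by the matrix `R`. -/
noncomputable def controlMul {m : ℕ} (R : Matrix (Fin m) (Fin m) ℝ) : Control m →L[ℝ] Control m :=
  (Matrix.toEuclideanCLM (𝕜 := ℝ) R).compLpL 2 (volume.restrict (Ioi (0 : ℝ)))

variable {m : ℕ} {R : Matrix (Fin m) (Fin m) ℝ}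

theorem inner_controlMul (R : Matrix (Fin m) (Fin m) ℝ) (u v : Control m) :
    inner ℝ u (controlMul R v) = ∫ t in Ioi (0 : ℝ), (u t).ofLp ⬝ᵥ (R *ᵥ (v t).ofLp) := by
  rw [L2.inner_def]
  refine integral_congr_ae ?_
  filter_upwards [ContinuousLinearMap.coeFn_compLpL (p := 2)
    (Matrix.toEuclideanCLM (𝕜 := ℝ) R) v] with t ht
  rw [controlMul, ht, Matrix.inner_toEuclideanCLM]

theorem integrable_quadratic (R : Matrix (Fin m) (Fin m) ℝ) (u : Control m) :
    Integrable (fun t => (u t).ofLp ⬝ᵥ (R *ᵥ (u t).ofLp)) (volume.restrict (Ioi (0 : ℝ))) := by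
  refine (L2.integrable_inner (𝕜 := ℝ) u (controlMul R u)).congr ?_
  filter_upwards [ContinuousLinearMap.coeFn_compLpL (p := 2)
    (Matrix.toEuclideanCLM (𝕜 := ℝ) R) u] with t ht
  rw [controlMul, ht, Matrix.inner_toEuclideanCLM]

theorem quadratic_nonneg (hR : R.PosDef) (v : EuclideanSpace ℝ (Fin m)) :
    0 ≤ v.ofLp ⬝ᵥ (R *ᵥ v.ofLp) := by
  have := hR.posSemidef.dotProduct_mulVec_nonneg v.ofLp
  simpa using this

theorem lintegral_quadratic (hR : R.PosDef) (u : Control m) :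
    ∫⁻ t in Ioi (0 : ℝ), ENNReal.ofReal ((u t).ofLp ⬝ᵥ (R *ᵥ (u t).ofLp)) =
      ENNReal.ofReal (inner ℝ u (controlMul R u)) := by
  rw [inner_controlMul, ofReal_integral_eq_lintegral_ofReal (integrable_quadratic R u)
    (Eventually.of_forall fun t => quadratic_nonneg hR _)]

theorem inner_controlMul_symm (hR : R.PosDef) (u v : Control m) :
    inner ℝ u (controlMul R v) = inner ℝ (controlMul R u) v := by
  rw [real_inner_comm v, inner_controlMul, inner_controlMul]
  refine integral_congr_ae (Eventually.of_forall fun t => ?_)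
  have hT : Rᵀ = R := by simpa using hR.isHermitian.eq
  simp only
  rw [Matrix.dotProduct_mulVec, ← Matrix.mulVec_transpose, hT, dotProduct_comm]

theorem mul_sq_norm_le_inner_controlMul {c : ℝ}
    (hc : ∀ v : EuclideanSpace ℝ (Fin m),
      c * ‖v‖ ^ 2 ≤ inner ℝ v (Matrix.toEuclideanCLM (𝕜 := ℝ) R v)) (u : Control m) :
    c * ‖u‖ ^ 2 ≤ inner ℝ u (controlMul R u) := by
  rw [inner_controlMul, ← real_inner_self_eq_norm_sq, L2.inner_def, ← integral_const_mul]
  refine integral_mono ((L2.integrable_inner u u).const_mul c) (integrable_quadratic R u) fun t => ?_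
  simp only
  rw [real_inner_self_eq_norm_sq, ← Matrix.inner_toEuclideanCLM]
  exact hc _

theorem inner_controlMul_nonneg (hR : R.PosDef) (u : Control m) :
    0 ≤ inner ℝ u (controlMul R u) := by
  rw [inner_controlMul]
  exact integral_nonneg fun t => quadratic_nonneg hR _

end QuadReg

/-! ### Compactness of trajectories. -/

/-- A pointwise form of the Arzelà–Ascoli theorem on the real line. -/
theorem exists_subseq_tendsto_of_equicontinuous {E : Type*} [NormedAddCommGroup E]
    [ProperSpace E] {y : ℕ → ℝ → E} {M : ℝ} (hM : ∀ k t, ‖y k t‖ ≤ M)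
    (heq : ∀ ε > 0, ∃ δ > 0, ∀ k s t, dist s t < δ → dist (y k s) (y k t) ≤ ε) :
    ∃ (φ : ℕ → ℕ) (z : ℝ → E), StrictMono φ ∧ Continuous z ∧
      ∀ t, Tendsto (fun k => y (φ k) t) atTop (𝓝 (z t)) := by
  -- Sequential compactness of the countable product replaces the diagonal argument; equicontinuity
  -- then carries convergence from ℚ to ℝ.
  have hcomp : IsCompact (Set.pi univ fun _ : ℚ => Metric.closedBall (0 : E) M) :=
    isCompact_univ_pi fun _ => isCompact_closedBall _ _
  obtain ⟨g, -, φ, hφ, hg⟩ := hcomp.tendsto_subseq (x := fun k (q : ℚ) => y k q)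
    (fun k q _ => by simpa using hM k q)
  rw [tendsto_pi_nhds] at hg
  have hcau : ∀ t, CauchySeq fun k => y (φ k) t := by
    intro t
    rw [Metric.cauchySeq_iff]
    intro ε hε
    obtain ⟨δ, hδ, H⟩ := heq (ε / 4) (by positivity)
    obtain ⟨q, hq⟩ := Rat.denseRange_cast.exists_dist_lt t hδ
    obtain ⟨N, hN⟩ := Metric.cauchySeq_iff.1 (hg q).cauchySeq (ε / 4) (by positivity)
    refine ⟨N, fun i hi j hj => ?_⟩
    have h1 := H (φ i) t q hq
    have h2 := H (φ j) t q hq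
    have h3 := hN i hi j hj
    simp only [Function.comp_apply] at h3
    have h4 := dist_triangle4_right (y (φ i) t) (y (φ j) t) (y (φ i) q) (y (φ j) q)
    linarith
  choose z hz using fun t => cauchySeq_tendsto_of_complete (hcau t)
  refine ⟨φ, z, hφ, ?_, hz⟩
  rw [Metric.continuous_iff]
  intro t ε hε
  obtain ⟨δ, hδ, H⟩ := heq (ε / 2) (by positivity)
  refine ⟨δ, hδ, fun s hs => ?_⟩
  have : dist (z s) (z t) ≤ ε / 2 :=
    le_of_tendsto ((hz s).dist (hz t)) (Eventually.of_forall fun k => H _ _ _ hs)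
  linarith

namespace QuadReg

variable {n m : ℕ} {a : EuclideanSpace ℝ (Fin n) → EuclideanSpace ℝ (Fin n)}
  {b : EuclideanSpace ℝ (Fin n) → EuclideanSpace ℝ (Fin m) →L[ℝ] EuclideanSpace ℝ (Fin n)}
  {x₀ : EuclideanSpace ℝ (Fin n)} {u : Control m} {x : ℝ → EuclideanSpace ℝ (Fin n)} {T : ℝ}

theorem memLp_control_restrict (u : Control m) (T : ℝ) :
    MemLp u 2 (volume.restrict (Ioc 0 T)) :=
  (Lp.memLp u).mono_measure (Measure.restrict_mono Ioc_subset_Ioi_self le_rfl)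

theorem intervalIntegrable_control_term (hb : Continuous b) (u : Control m) (hT : 0 ≤ T)
    (hx : ContinuousOn x (Icc 0 T)) :
    IntervalIntegrable (fun t => b (x t) (u t)) volume 0 T := by
  rw [intervalIntegrable_iff_integrableOn_Ioc_of_le hT]
  have hbx : ContinuousOn (fun t => b (x t)) (Icc 0 T) := hb.comp_continuousOn hx
  obtain ⟨C, hC⟩ := isCompact_Icc.exists_bound_of_continuousOn hbx
  have hu : Integrable u (volume.restrict (Ioc 0 T)) :=
    (memLp_control_restrict u T).integrable one_le_two
  refine (hu.norm.const_mul C).mono' ?_ ?_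
  · exact (ContinuousLinearMap.id ℝ _).aestronglyMeasurable_comp₂
      ((hbx.mono Ioc_subset_Icc_self).aestronglyMeasurable measurableSet_Ioc)
      hu.aestronglyMeasurable
  · refine (ae_restrict_iff' measurableSet_Ioc).2 (Eventually.of_forall fun t ht => ?_)
    exact (b (x t)).le_of_opNorm_le (hC t (Ioc_subset_Icc_self ht)) _

theorem intervalIntegrable_field (ha : Continuous a) (hb : Continuous b) (u : Control m)
    (hT : 0 ≤ T) (hx : ContinuousOn x (Icc 0 T)) :
    IntervalIntegrable (fun t => a (x t) + b (x t) (u t)) volume 0 T := by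
  refine IntervalIntegrable.add ?_ (intervalIntegrable_control_term hb u hT hx)
  refine ContinuousOn.intervalIntegrable ?_
  rw [uIcc_of_le hT]
  exact ha.comp_continuousOn hx

theorem IsSolutionOn.mono (h : IsSolutionOn a b x₀ u x T) {t : ℝ} (h0 : 0 ≤ t) (ht : t ≤ T) :
    IsSolutionOn a b x₀ u x t where
  absolutelyContinuous := h.absolutelyContinuous.mono (by
    rw [uIcc_of_le h0, uIcc_of_le (h0.trans ht)]; exact Icc_subset_Icc_right ht)
  initial := h.initial
  hasDerivAt := ae_mono (Measure.restrict_mono (Ioo_subset_Ioo_right ht) le_rfl) h.hasDerivAt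

theorem IsSolutionOn.continuousOn (h : IsSolutionOn a b x₀ u x T) (hT : 0 ≤ T) :
    ContinuousOn x (Icc 0 T) := by
  have := h.absolutelyContinuous.continuousOn
  rwa [uIcc_of_le hT] at this

theorem IsSolutionOn.integral_eq (ha : Continuous a) (hb : Continuous b)
    (h : IsSolutionOn a b x₀ u x T) {s t : ℝ} (h0 : 0 ≤ s) (hst : s ≤ t) (htT : t ≤ T) :
    ∫ r in s..t, (a (x r) + b (x r) (u r)) = x t - x s := by
  have hT : 0 ≤ T := h0.trans (hst.trans htT)
  have hsub : uIcc s t ⊆ uIcc 0 T := by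
    rw [uIcc_of_le hst, uIcc_of_le hT]; exact Icc_subset_Icc h0 htT
  refine (h.absolutelyContinuous.mono hsub).integral_eq_sub_of_hasDerivAt hst ?_ ?_
  · exact ae_mono (Measure.restrict_mono (Ioo_subset_Ioo h0 htT) le_rfl) h.hasDerivAt
  · exact (intervalIntegrable_field ha hb u hT (h.continuousOn hT)).mono_set hsub

/-- The integral form is the one that survives pointwise limits of trajectories. -/
theorem isSolutionOn_of_integral_eq (ha : Continuous a) (hb : Continuous b) (hT : 0 ≤ T)
    (hx : ContinuousOn x (Icc 0 T))
    (h : ∀ t ∈ Icc 0 T, x t = x₀ + ∫ r in (0 : ℝ)..t, (a (x r) + b (x r) (u r))) :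
    IsSolutionOn a b x₀ u x T where
  absolutelyContinuous := by
    refine (intervalIntegrable_field ha hb u hT
      hx).absolutelyContinuousOnInterval_integral.of_dist_le fun s hs t ht => ?_
    rw [uIcc_of_le hT] at hs ht
    rw [h s hs, h t ht, dist_add_left]
  initial := by simpa using h 0 ⟨le_rfl, hT⟩
  hasDerivAt := by
    rw [ae_restrict_iff' measurableSet_Ioo]
    filter_upwards [(intervalIntegrable_field ha hb u hT hx).ae_hasDerivAt_integral] with t h1 ht
    rw [uIcc_of_le hT] at h1
    refine ((h1 (Ioo_subset_Icc_self ht) 0 ⟨le_rfl, hT⟩).const_add x₀).congr_of_eventuallyEq ?_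
    filter_upwards [Ioo_mem_nhds ht.1 ht.2] with s hs
    exact h s (Ioo_subset_Icc_self hs)

theorem setIntegral_sq_norm_control_le (u : Control m) {s t : ℝ} (h0 : 0 ≤ s) :
    IntegrableOn (fun r => ‖u r‖ ^ 2) (Ioc s t) ∧ ∫ r in Ioc s t, ‖u r‖ ^ 2 ≤ ‖u‖ ^ 2 := by
  have hint : IntegrableOn (fun r => ‖u r‖ ^ 2) (Ioi 0) :=
    (L2.integrable_inner (𝕜 := ℝ) u u).congr
      (Eventually.of_forall fun r => real_inner_self_eq_norm_sq _)
  have hsub : Ioc s t ⊆ Ioi 0 := fun r hr => h0.trans_lt hr.1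
  refine ⟨hint.mono_set hsub, ?_⟩
  rw [← real_inner_self_eq_norm_sq u, L2.inner_def]
  simp only [real_inner_self_eq_norm_sq]
  exact setIntegral_mono_set hint (Eventually.of_forall fun r => sq_nonneg _) hsub.eventuallyLE

/-- A modulus of continuity depending on u only through its norm. The free parameter η comes from
‖u‖ ≤ η⁻¹ + η‖u‖², used in place of Cauchy–Schwarz: η small controls the last term, then t - s small
the first. -/
theorem IsSolutionOn.dist_le (ha : Continuous a) (hb : Continuous b)
    (h : IsSolutionOn a b x₀ u x T) {A : ℝ} (hA0 : 0 ≤ A)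
    (haA : ∀ t ∈ Icc 0 T, ‖a (x t)‖ ≤ A) (hbA : ∀ t ∈ Icc 0 T, ‖b (x t)‖ ≤ A)
    {η : ℝ} (hη : 0 < η) {s t : ℝ} (h0 : 0 ≤ s) (hst : s ≤ t) (htT : t ≤ T) :
    dist (x s) (x t) ≤ A * (1 + η⁻¹) * (t - s) + A * η * ‖u‖ ^ 2 := by
  obtain ⟨hint, hle⟩ := setIntegral_sq_norm_control_le u (s := s) (t := t) h0
  rw [dist_comm, dist_eq_norm, ← h.integral_eq ha hb h0 hst htT]
  have hint' : IntervalIntegrable (fun r => A * (1 + η⁻¹) + A * η * ‖u r‖ ^ 2) volume s t := by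
    refine intervalIntegrable_const.add (IntervalIntegrable.const_mul ?_ _)
    exact (intervalIntegrable_iff_integrableOn_Ioc_of_le hst).2 hint
  have hbound : ∀ r ∈ Ioc s t, ‖a (x r) + b (x r) (u r)‖ ≤ A * (1 + η⁻¹) + A * η * ‖u r‖ ^ 2 := by
    intro r hr
    have hr' : r ∈ Icc 0 T := ⟨h0.trans hr.1.le, hr.2.trans htT⟩
    have h1 := norm_add_le_of_le (haA r hr') ((b (x r)).le_of_opNorm_le (hbA r hr') (u r))
    have h2 : ‖u r‖ ≤ η⁻¹ + η * ‖u r‖ ^ 2 := by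
      have h3 : 0 ≤ η⁻¹ * ((η * ‖u r‖ - 1) ^ 2 + η * ‖u r‖) := by positivity
      have h4 : η⁻¹ * ((η * ‖u r‖ - 1) ^ 2 + η * ‖u r‖) = η⁻¹ + η * ‖u r‖ ^ 2 - ‖u r‖ := by
        field_simp; ring
      linarith
    nlinarith [mul_le_mul_of_nonneg_left h2 hA0]
  refine (intervalIntegral.norm_integral_le_of_norm_le hst
    (Eventually.of_forall hbound) hint').trans ?_
  rw [intervalIntegral.integral_add intervalIntegrable_const
    (((intervalIntegrable_iff_integrableOn_Ioc_of_le hst).2 hint).const_mul _),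
    intervalIntegral.integral_const, intervalIntegral.integral_const_mul,
    intervalIntegral.integral_of_le hst, smul_eq_mul, mul_comm (t - s)]
  gcongr

/-- Pairing a bounded, pointwise convergent field of operators with a weakly convergent sequence
of controls. -/
theorem tendsto_integral_control_term (hb : Continuous b) {y : ℕ → ℝ → EuclideanSpace ℝ (Fin n)}
    {z : ℝ → EuclideanSpace ℝ (Fin n)} (hy : ∀ k, Continuous (y k)) (hz : Continuous z)
    (hyz : ∀ t, Tendsto (fun k => y k t) atTop (𝓝 (z t))) {B : ℝ}
    (hyB : ∀ k t, ‖b (y k t)‖ ≤ B) {u : ℕ → Control m} {uInf : Control m} {C : ℝ}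
    (hC : ∀ k, ‖u k‖ ≤ C)
    (hu : ∀ w : Control m, Tendsto (fun k => inner ℝ w (u k)) atTop (𝓝 (inner ℝ w uInf)))
    (v : EuclideanSpace ℝ (Fin n)) {t : ℝ} (ht : 0 ≤ t) :
    Tendsto (fun k => inner ℝ v (∫ s in (0 : ℝ)..t, b (y k s) (u k s))) atTop
      (𝓝 (inner ℝ v (∫ s in (0 : ℝ)..t, b (z s) (uInf s)))) := by
  have hzB : ∀ s, ‖b (z s)‖ ≤ B := fun s =>
    le_of_tendsto ((hb.tendsto _).comp (hyz s)).norm (Eventually.of_forall fun k => hyB k s)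
  -- the test fields
  let g : (ℝ → EuclideanSpace ℝ (Fin n)) → ℝ → EuclideanSpace ℝ (Fin m) := fun x =>
    (Ioc 0 t).indicator fun s => ContinuousLinearMap.adjoint (b (x s)) v
  have hadj : Continuous fun L : EuclideanSpace ℝ (Fin m) →L[ℝ] EuclideanSpace ℝ (Fin n) =>
      ContinuousLinearMap.adjoint L := LinearIsometryEquiv.continuous _
  have hcont : ∀ x : ℝ → EuclideanSpace ℝ (Fin n), Continuous x → Continuous fun s => ContinuousLinearMap.adjoint (b (x s)) v :=
    fun x hx => (hadj.comp (hb.comp hx)).clm_apply continuous_const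
  have hgB : ∀ x : ℝ → EuclideanSpace ℝ (Fin n), (∀ s, ‖b (x s)‖ ≤ B) → ∀ s,
      ‖g x s‖ ≤ (Ioc 0 t).indicator (fun _ => B * ‖v‖) s := by
    intro x hx s
    by_cases hs : s ∈ Ioc 0 t
    · simp only [g, indicator_of_mem hs]
      refine ContinuousLinearMap.le_of_opNorm_le _ ?_ _
      rw [LinearIsometryEquiv.norm_map]
      exact hx s
    · simp [g, indicator_of_notMem hs]
  have hmem : ∀ x : ℝ → EuclideanSpace ℝ (Fin n), Continuous x → (∀ s, ‖b (x s)‖ ≤ B) →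
      MemLp (g x) 2 (volume.restrict (Ioi (0 : ℝ))) := by
    intro x hx hxB
    refine (memLp_indicator_const (μ := volume.restrict (Ioi (0 : ℝ))) 2
      (measurableSet_Ioc (a := (0 : ℝ)) (b := t)) (B * ‖v‖) (Or.inr ?_)).mono ?_ ?_
    · exact ((Measure.restrict_apply_le _ _).trans_lt (by simp)).ne
    · exact (hcont x hx).aestronglyMeasurable.indicator measurableSet_Ioc
    · exact Eventually.of_forall fun s => (hgB x hxB s).trans (le_abs_self _)
  -- The adjoint moves b(x) onto v, so the integral becomes an L² pairing of the control with a test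
  -- field.
  have hpair : ∀ (x : ℝ → EuclideanSpace ℝ (Fin n)) (hx : Continuous x) (hxB : ∀ s, ‖b (x s)‖ ≤ B) (w : Control m),
      inner ℝ ((hmem x hx hxB).toLp _) w = inner ℝ v (∫ s in (0 : ℝ)..t, b (x s) (w s)) := by
    intro x hx hxB w
    have hint := intervalIntegrable_control_term hb w ht hx.continuousOn
    rw [intervalIntegrable_iff_integrableOn_Ioc_of_le ht] at hint
    rw [L2.inner_def, intervalIntegral.integral_of_le ht, ← integral_inner hint]
    have : ∫ s in Ioi (0 : ℝ), inner ℝ ((hmem x hx hxB).toLp _ s) (w s) =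
        ∫ s in Ioi (0 : ℝ), (Ioc 0 t).indicator (fun s => inner ℝ v (b (x s) (w s))) s := by
      refine integral_congr_ae ?_
      filter_upwards [(hmem x hx hxB).coeFn_toLp] with s hs
      rw [hs]
      by_cases h : s ∈ Ioc 0 t
      · simp only [g, indicator_of_mem h, ContinuousLinearMap.adjoint_inner_left]
      · simp [g, indicator_of_notMem h]
    rw [this, integral_indicator measurableSet_Ioc, Measure.restrict_restrict measurableSet_Ioc,
      inter_eq_self_of_subset_left Ioc_subset_Ioi_self]
  simp only [← hpair z hz hzB, ← hpair (y _) (hy _) (hyB _)]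
  -- Strong times weak: the test fields converge in L² norm by dominated convergence, so replacing
  -- the k-th field by its limit costs an error of at most that distance times C.
  have hstrong : Tendsto (fun k => (hmem (y k) (hy k) (hyB k)).toLp _ - (hmem z hz hzB).toLp _)
      atTop (𝓝 0) := by
    rw [tendsto_zero_iff_norm_tendsto_zero]
    have hsq : Tendsto (fun k => ‖(hmem (y k) (hy k) (hyB k)).toLp _ -
        (hmem z hz hzB).toLp _‖ ^ 2) atTop (𝓝 0) := by
      have heq : ∀ k, ‖(hmem (y k) (hy k) (hyB k)).toLp _ - (hmem z hz hzB).toLp _‖ ^ 2 =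
          ∫ s in Ioi (0 : ℝ), ‖g (y k) s - g z s‖ ^ 2 := by
        intro k
        rw [← real_inner_self_eq_norm_sq, L2.inner_def]
        refine integral_congr_ae ?_
        rw [← MemLp.toLp_sub]
        filter_upwards [((hmem (y k) (hy k) (hyB k)).sub (hmem z hz hzB)).coeFn_toLp] with s hs
        rw [hs, real_inner_self_eq_norm_sq, Pi.sub_apply]
      simp only [heq]
      suffices Tendsto (fun k => ∫ s in Ioi (0 : ℝ), ‖g (y k) s - g z s‖ ^ 2) atTop
          (𝓝 (∫ _ in Ioi (0 : ℝ), (0 : ℝ))) by simpa using this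
      refine tendsto_integral_of_dominated_convergence
        ((Ioc 0 t).indicator fun _ => (B * ‖v‖ + B * ‖v‖) ^ 2) ?_ ?_ ?_ ?_
      · intro k
        exact ((((hcont (y k) (hy k)).stronglyMeasurable.indicator measurableSet_Ioc).sub
          ((hcont z hz).stronglyMeasurable.indicator
            measurableSet_Ioc)).norm.pow 2).aestronglyMeasurable
      · refine IntegrableOn.integrable_indicator ?_ measurableSet_Ioc
        exact integrableOn_const ((Measure.restrict_apply_le _ _).trans_lt (by simp)).ne
      · refine fun k => Eventually.of_forall fun s => ?_
        have h1 := hgB _ (hyB k) s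
        have h2 := hgB _ hzB s
        by_cases hs : s ∈ Ioc 0 t
        · rw [indicator_of_mem hs] at h1 h2 ⊢
          rw [Real.norm_of_nonneg (by positivity)]
          gcongr
          exact (norm_sub_le _ _).trans (add_le_add h1 h2)
        · simp [g, indicator_of_notMem hs]
      · refine Eventually.of_forall fun s => ?_
        have : Tendsto (fun k => g (y k) s) atTop (𝓝 (g z s)) := by
          by_cases hs : s ∈ Ioc 0 t
          · simp only [g, indicator_of_mem hs]
            have hc : Continuous fun w => ContinuousLinearMap.adjoint (b w) v :=
              (hadj.comp hb).clm_apply continuous_const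
            exact (hc.tendsto _).comp (hyz s)
          · simp [g, indicator_of_notMem hs]
        simpa using (this.sub_const (g z s)).norm.pow 2
    have := hsq.sqrt
    simpa using this
  have hsmall : Tendsto (fun k => inner ℝ ((hmem (y k) (hy k) (hyB k)).toLp _ -
      (hmem z hz hzB).toLp _) (u k)) atTop (𝓝 0) := by
    refine squeeze_zero_norm (fun k => (norm_inner_le_norm _ _).trans
      (mul_le_mul_of_nonneg_left (hC k) (norm_nonneg _))) ?_
    simpa using hstrong.norm.mul_const C
  have := hsmall.add (hu ((hmem z hz hzB).toLp _))
  rw [zero_add] at this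
  refine this.congr fun k => ?_
  rw [inner_sub_left]
  ring

/-- Solutions with weakly convergent controls and uniformly bounded trajectories on growing
intervals converge, along a subsequence, to a solution with the limit control. -/
theorem exists_subseq_tendsto_isSolutionOn (ha : Continuous a) (hb : Continuous b)
    {T : ℕ → ℝ} (hT0 : ∀ k, 0 < T k) (hT : Tendsto T atTop atTop)
    {u : ℕ → Control m} {uInf : Control m} {C M : ℝ} (hC : ∀ k, ‖u k‖ ≤ C)
    (hu : ∀ w : Control m, Tendsto (fun k => inner ℝ w (u k)) atTop (𝓝 (inner ℝ w uInf)))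
    {x : ℕ → ℝ → EuclideanSpace ℝ (Fin n)} (hx : ∀ k, IsSolutionOn a b x₀ (u k) (x k) (T k))
    (hM : ∀ k, ∀ t ∈ Icc 0 (T k), ‖x k t‖ ≤ M) :
    ∃ (φ : ℕ → ℕ) (z : ℝ → EuclideanSpace ℝ (Fin n)), StrictMono φ ∧
      (∀ t, 0 ≤ t → Tendsto (fun k => x (φ k) t) atTop (𝓝 (z t))) ∧
      ∀ T, 0 ≤ T → IsSolutionOn a b x₀ uInf z T := by
  obtain ⟨A₁, hA₁⟩ := (isCompact_closedBall (0 : EuclideanSpace ℝ (Fin n))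
    M).exists_bound_of_continuousOn ha.continuousOn
  obtain ⟨A₂, hA₂⟩ := (isCompact_closedBall (0 : EuclideanSpace ℝ (Fin n))
    M).exists_bound_of_continuousOn hb.continuousOn
  -- The 1 makes A positive, so that one may divide by it below.
  let A := max (max A₁ A₂) 1
  have hA : 0 < A := one_pos.trans_le (le_max_right _ _)
  have haA : ∀ v, ‖v‖ ≤ M → ‖a v‖ ≤ A := fun v hv =>
    (hA₁ v (by simpa using hv)).trans ((le_max_left _ _).trans (le_max_left _ _))
  have hbA : ∀ v, ‖v‖ ≤ M → ‖b v‖ ≤ A := fun v hv =>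
    (hA₂ v (by simpa using hv)).trans ((le_max_right _ _).trans (le_max_left _ _))
  -- constant extension of the trajectories
  let y : ℕ → ℝ → EuclideanSpace ℝ (Fin n) := fun k t => x k (projIcc 0 (T k) (hT0 k).le t)
  have hyx : ∀ k t, t ∈ Icc 0 (T k) → y k t = x k t := fun k t ht => by
    simp only [y, projIcc_of_mem (hT0 k).le ht]
  have hyM : ∀ k t, ‖y k t‖ ≤ M := fun k t => hM k _ (projIcc 0 (T k) (hT0 k).le t).2
  have hyc : ∀ k, Continuous (y k) := fun k =>
    ((hx k).continuousOn (hT0 k).le).domRestrict.comp continuous_projIcc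
  have hmod : ∀ η > 0, ∀ k s t, s ≤ t →
      dist (y k s) (y k t) ≤ A * (1 + η⁻¹) * (t - s) + A * η * C ^ 2 := by
    intro η hη k s t hst
    refine ((hx k).dist_le ha hb hA.le (fun r hr => haA _ (hM k r hr))
      (fun r hr => hbA _ (hM k r hr)) hη (projIcc 0 (T k) (hT0 k).le s).2.1
      (monotone_projIcc (hT0 k).le hst) (projIcc 0 (T k) (hT0 k).le t).2.2).trans ?_
    have h1 : ((projIcc 0 (T k) (hT0 k).le t : ℝ) - projIcc 0 (T k) (hT0 k).le s) ≤ t - s := by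
      simp only [coe_projIcc]
      rcases le_total (T k) t with h1 | h1 <;> rcases le_total (T k) s with h2 | h2 <;>
      rcases le_total 0 t with h3 | h3 <;> rcases le_total 0 s with h4 | h4 <;>
      simp [h1, h2, h3, h4, (hT0 k).le] <;> linarith [hT0 k]
    gcongr
    exact hC k
  obtain ⟨φ, z, hφ, hz, hyz⟩ := exists_subseq_tendsto_of_equicontinuous hyM (by
    intro ε hε
    -- With this η the term A η C² is at most ε/2 (the +1 covers C = 0); the δ below makes the other
    -- term of `hmod` less than ε/2.
    have hη : 0 < ε / (2 * A * (C ^ 2 + 1)) := by positivity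
    refine ⟨ε / (2 * A * (1 + (ε / (2 * A * (C ^ 2 + 1)))⁻¹)), by positivity, ?_⟩
    have key : ∀ k s t, s ≤ t →
        dist s t < ε / (2 * A * (1 + (ε / (2 * A * (C ^ 2 + 1)))⁻¹)) →
        dist (y k s) (y k t) ≤ ε := by
      intro k s t hst hd
      refine (hmod _ hη k s t hst).trans ?_
      rw [dist_comm, Real.dist_eq, abs_of_nonneg (sub_nonneg.2 hst),
        lt_div_iff₀ (by positivity)] at hd
      have h2 : A * (ε / (2 * A * (C ^ 2 + 1))) * C ^ 2 ≤ ε / 2 := by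
        have : A * (ε / (2 * A * (C ^ 2 + 1))) * C ^ 2 = ε / 2 * (C ^ 2 / (C ^ 2 + 1)) := by
          field_simp
        rw [this]
        refine mul_le_of_le_one_right (by positivity) ?_
        rw [div_le_one (by positivity)]
        linarith
      linarith
    intro k s t hd
    rcases le_total s t with h | h
    · exact key k s t h hd
    · rw [dist_comm] at hd ⊢
      exact key k t s h hd)
  have hzx : ∀ t, 0 ≤ t → Tendsto (fun k => x (φ k) t) atTop (𝓝 (z t)) := by
    intro t ht
    refine (hyz t).congr' ?_
    filter_upwards [(hT.comp hφ.tendsto_atTop).eventually_ge_atTop t] with k hk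
    exact hyx _ _ ⟨ht, hk⟩
  refine ⟨φ, z, hφ, hzx, fun S hS => isSolutionOn_of_integral_eq ha hb hS hz.continuousOn ?_⟩
  intro t ht
  -- Weak convergence of controls yields only scalar limits, so the integral equation is tested
  -- against each v.
  refine ext_inner_left ℝ fun v => ?_
  have hlimA : Tendsto (fun k => ∫ s in (0 : ℝ)..t, a (y (φ k) s)) atTop
      (𝓝 (∫ s in (0 : ℝ)..t, a (z s))) := by
    refine intervalIntegral.tendsto_integral_filter_of_dominated_convergence (fun _ => A) ?_ ?_
      intervalIntegrable_const ?_
    · exact Eventually.of_forall fun k => (ha.comp (hyc _)).aestronglyMeasurable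
    · exact Eventually.of_forall fun k => Eventually.of_forall fun s _ => haA _ (hyM _ s)
    · exact Eventually.of_forall fun s _ => (ha.tendsto _).comp (hyz s)
  have hlimB := tendsto_integral_control_term hb (fun k => hyc (φ k)) hz hyz
    (fun k s => hbA _ (hyM _ s)) (fun k => hC (φ k))
    (fun w => (hu w).comp hφ.tendsto_atTop) v ht.1
  have haint : ∀ w : ℝ → EuclideanSpace ℝ (Fin n), Continuous w →
      IntervalIntegrable (fun s => a (w s)) volume 0 t := fun w hw =>
    (ha.comp hw).intervalIntegrable _ _
  have hlim := ((tendsto_const_nhds (x := inner ℝ v x₀)).add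
    ((tendsto_const_nhds (x := v)).inner hlimA)).add hlimB
  rw [intervalIntegral.integral_add (haint z hz)
    (intervalIntegrable_control_term hb uInf ht.1 hz.continuousOn), inner_add_right,
    inner_add_right, ← add_assoc]
  refine tendsto_nhds_unique ((tendsto_const_nhds (x := v)).inner (hzx t ht.1)) (hlim.congr' ?_)
  filter_upwards [(hT.comp hφ.tendsto_atTop).eventually_ge_atTop t] with k hk
  have h1 := (hx (φ k)).integral_eq ha hb le_rfl ht.1 hk
  rw [(hx (φ k)).initial, eq_sub_iff_add_eq] at h1
  rw [← h1, ← inner_add_right, ← inner_add_right,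
    add_assoc, ← intervalIntegral.integral_add (haint _ (hyc _))
      (intervalIntegrable_control_term hb _ ht.1 (hyc _).continuousOn), add_comm x₀]
  congr 2
  refine intervalIntegral.integral_congr fun s hs => ?_
  rw [uIcc_of_le ht.1] at hs
  simp only [hyx (φ k) s ⟨hs.1, hs.2.trans hk⟩]

end QuadReg

/-! ### Comparison of horizons and lower semicontinuity of the cost. -/

theorem ENNReal.liminf_add_liminf_le {f g : ℕ → ℝ≥0∞} :
    liminf f atTop + liminf g atTop ≤ liminf (fun k => f k + g k) atTop := by
  simp only [liminf_eq_iSup_iInf_of_nat]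
  rw [ENNReal.iSup_add_iSup_of_monotone]
  · exact iSup_mono fun N => le_iInf₂ fun k hk => add_le_add (iInf₂_le k hk) (iInf₂_le k hk)
  · exact fun i j hij => le_iInf₂ fun k hk => iInf₂_le k (hij.trans hk)
  · exact fun i j hij => le_iInf₂ fun k hk => iInf₂_le k (hij.trans hk)

namespace QuadReg

variable {n m : ℕ} {a : EuclideanSpace ℝ (Fin n) → EuclideanSpace ℝ (Fin n)}
  {b : EuclideanSpace ℝ (Fin n) → EuclideanSpace ℝ (Fin m) →L[ℝ] EuclideanSpace ℝ (Fin n)}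
  {x₀ : EuclideanSpace ℝ (Fin n)} {ℓ₁ : ℝ → EuclideanSpace ℝ (Fin n) → ℝ≥0∞}
  {R : Matrix (Fin m) (Fin m) ℝ} {T : ℝ}

theorem jointFunctional_of_mem {ℓ : ℝ → EuclideanSpace ℝ (Fin n) → EuclideanSpace ℝ (Fin m) → ℝ≥0∞}
    {I : Set ℝ} {A : Set (Control m × State n)} {p : Control m × State n} (hp : p ∈ A) :
    jointFunctional ℓ I A p = ∫⁻ t in I, ℓ t (p.2.1 t) (p.1 t) := by
  simp [jointFunctional, hp]

theorem mem_of_jointFunctional_ne_top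
    {ℓ : ℝ → EuclideanSpace ℝ (Fin n) → EuclideanSpace ℝ (Fin m) → ℝ≥0∞}
    {I : Set ℝ} {A : Set (Control m × State n)} {p : Control m × State n}
    (hp : jointFunctional ℓ I A p ≠ ⊤) : p ∈ A := by
  by_contra h
  exact hp (by simp [jointFunctional, h])

/-- Stopping an absolutely continuous trajectory at time `T` and letting it decay exponentially
afterwards gives an absolutely continuous trajectory. -/
theorem absolutelyContinuousOnInterval_stopped {x : ℝ → EuclideanSpace ℝ (Fin n)} (hT : 0 ≤ T)
    (hx : AbsolutelyContinuousOnInterval x 0 T) {S : ℝ} (hS : 0 ≤ S) :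
    AbsolutelyContinuousOnInterval
      (fun t => Real.exp (-(max t T - T)) • x (min t T)) 0 S := by
  have h1 : AbsolutelyContinuousOnInterval (fun t => x (min t T)) 0 S := by
    refine hx.comp_monotone_lipschitz (monotone_id.min monotone_const) (fun s t => ?_) ?_
    · exact abs_inf_sub_inf_le_abs s t T
    · rw [uIcc_of_le hT, uIcc_of_le hS]
      exact fun t ht => ⟨le_min ht.1 hT, min_le_right _ _⟩
  have h2 : AbsolutelyContinuousOnInterval (fun r => Real.exp (-(r - T))) T (max S T) :=
    ContDiffOn.absolutelyContinuousOnInterval (by fun_prop)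
  have h3 : AbsolutelyContinuousOnInterval (fun t => Real.exp (-(max t T - T))) 0 S := by
    refine h2.comp_monotone_lipschitz (φ := fun t => max t T)
      (monotone_id.max monotone_const) (fun s t => ?_) ?_
    · exact abs_sup_sub_sup_le_abs s t T
    · rw [uIcc_of_le (le_max_right S T), uIcc_of_le hS]
      exact fun t ht => ⟨le_max_right _ _, max_le_max_right _ ht.2⟩
  exact h3.fun_smul h1

/-- Cut the control off after T and let the state decay. Agreement is only a.e. because controls are
L² classes. -/
theorem exists_mem_admissibleFin (hT : 0 < T) {p : Control m × State n}
    (hp : p ∈ admissibleInf a b x₀) :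
    ∃ q ∈ admissibleFin a b x₀ T,
      ∀ᵐ t ∂(volume.restrict (Ioo 0 T)), q.1 t = p.1 t ∧ q.2.1 t = p.2.1 t := by
  have hu := (Lp.memLp p.1).indicator (measurableSet_Iic (a := T))
  let x : State n := ⟨fun t => Real.exp (-(max t T - T)) • p.2.1 (min t T), fun S hS =>
    absolutelyContinuousOnInterval_stopped hT.le (p.2.2 T hT.le) hS⟩
  have hxp : ∀ t, t ≤ T → x.1 t = p.2.1 t := fun t ht => by simp [x, ht]
  have hup : ∀ᵐ t ∂(volume.restrict (Ioo 0 T)), hu.toLp _ t = p.1 t := by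
    have := ae_restrict_of_ae_restrict_of_subset
      (Ioo_subset_Ioi_self (a := T) (b := (0 : ℝ))) hu.coeFn_toLp
    filter_upwards [this, ae_restrict_mem measurableSet_Ioo] with t h1 h2
    rw [h1, indicator_of_mem (show t ∈ Iic T from h2.2.le)]
  refine ⟨(hu.toLp _, x), ⟨?_, ?_, ?_⟩, ?_⟩
  · have := ae_restrict_of_ae_restrict_of_subset (Ioi_subset_Ioi hT.le) hu.coeFn_toLp
    filter_upwards [this, ae_restrict_mem measurableSet_Ioi] with t h1 h2
    rw [h1, indicator_of_notMem (by simpa using h2)]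
  · have hs := hp T hT.le
    refine ⟨x.2 T hT.le, (hxp 0 hT.le).trans hs.initial, ?_⟩
    filter_upwards [hup, hs.hasDerivAt, ae_restrict_mem measurableSet_Ioo] with t h1 h2 h3
    rw [hxp t h3.2.le, h1]
    refine h2.congr_of_eventuallyEq ?_
    filter_upwards [Iio_mem_nhds h3.2] with s hs
    exact hxp s (le_of_lt hs)
  · intro t ht
    simp only [hxp T le_rfl]
    simp [x, ht.le]
  · filter_upwards [hup, ae_restrict_mem measurableSet_Ioo] with t h1 h2
    exact ⟨h1, hxp t h2.2.le⟩

/-- The optimal cost for a finite horizon is at most that for the infinite horizon. -/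
theorem iInf_regulatorFin_le (hT : 0 < T) :
    ⨅ p, regulatorFin a b ℓ₁ R x₀ T p ≤ ⨅ p, regulatorInf a b ℓ₁ R x₀ p := by
  refine le_iInf fun p => ?_
  by_cases hp : p ∈ admissibleInf a b x₀
  · obtain ⟨q, hq, hqp⟩ := exists_mem_admissibleFin hT hp
    refine (iInf_le _ q).trans ?_
    rw [regulatorFin, regulatorInf, jointFunctional_of_mem hq, jointFunctional_of_mem hp]
    refine le_trans (le_of_eq ?_) (lintegral_mono_set (Ioo_subset_Ioi_self (a := T)))
    refine lintegral_congr_ae ?_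
    filter_upwards [hqp] with t ht
    rw [ht.1, ht.2]
  · have : regulatorInf a b ℓ₁ R x₀ p = ⊤ := by simp [regulatorInf, jointFunctional, hp]
    rw [this]
    exact le_top

/-- The time factor of the product carries the completed σ-algebra, so composing with t ↦ (t, x t)
gives null-measurability, which suffices for values in `ℝ≥0∞`. -/
theorem IsNormalIntegrand.aemeasurable_comp (hℓ : IsNormalIntegrand ℓ₁)
    {x : ℝ → EuclideanSpace ℝ (Fin n)} (hx : Measurable x) :
    AEMeasurable (fun t => ℓ₁ t (x t)) (volume.restrict (Ioi (0 : ℝ))) := by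
  have hpair : Measurable (fun t : NullMeasurableSpace ℝ (volume.restrict (Ioi (0 : ℝ))) =>
      ((t, x t) : NullMeasurableSpace ℝ (volume.restrict (Ioi (0 : ℝ))) ×
        EuclideanSpace ℝ (Fin n))) :=
    measurable_id.prodMk fun s hs => (hx hs).nullMeasurableSet
  have : NullMeasurable (fun t => ℓ₁ t (x t)) (volume.restrict (Ioi (0 : ℝ))) :=
    fun s hs => (hℓ.measurable.comp hpair) hs
  exact this.aemeasurable

theorem lintegral_runningCost (x : ℝ → EuclideanSpace ℝ (Fin n)) (u : Control m)
    {I : Set ℝ} (hI : I ⊆ Ioi 0) :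
    ∫⁻ t in I, runningCost ℓ₁ R t (x t) (u t) =
      (∫⁻ t in I, ℓ₁ t (x t)) +
        ∫⁻ t in I, ENNReal.ofReal ((u t).ofLp ⬝ᵥ (R *ᵥ (u t).ofLp)) :=
  lintegral_add_right' _ ((integrable_quadratic R u).mono_measure
    (Measure.restrict_mono hI le_rfl)).aemeasurable.ennreal_ofReal

theorem setLIntegral_Ioo_eq_Ioi {f : ℝ → ℝ≥0∞} (hT : 0 ≤ T)
    (hf : ∀ᵐ t ∂(volume.restrict (Ioi T)), f t = 0) :
    ∫⁻ t in Ioo 0 T, f t = ∫⁻ t in Ioi 0, f t := by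
  rw [setLIntegral_congr Ioo_ae_eq_Ioc, ← Ioc_union_Ioi_eq_Ioi hT,
    lintegral_union measurableSet_Ioi Ioc_disjoint_Ioi_same, lintegral_congr_ae hf,
    lintegral_zero, add_zero]

/-- Since the control vanishes after T, its cost is the same quadratic form on the fixed space
L²(0,∞) for every horizon. -/
theorem regulatorFin_eq_of_mem (hR : R.PosDef) (hT : 0 < T) {p : Control m × State n}
    (hp : p ∈ admissibleFin a b x₀ T) :
    regulatorFin a b ℓ₁ R x₀ T p = (∫⁻ t in Ioo 0 T, ℓ₁ t (p.2.1 t)) +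
      ENNReal.ofReal (inner ℝ p.1 (controlMul R p.1)) := by
  rw [regulatorFin, jointFunctional_of_mem hp, lintegral_runningCost _ _ Ioo_subset_Ioi_self,
    ← lintegral_quadratic hR, setLIntegral_Ioo_eq_Ioi hT.le
      (f := fun t => ENNReal.ofReal ((p.1 t).ofLp ⬝ᵥ (R *ᵥ (p.1 t).ofLp)))]
  filter_upwards [hp.1] with t ht
  simp [ht]

theorem regulatorInf_eq_of_mem (hR : R.PosDef) {p : Control m × State n}
    (hp : p ∈ admissibleInf a b x₀) :
    regulatorInf a b ℓ₁ R x₀ p = (∫⁻ t in Ioi 0, ℓ₁ t (p.2.1 t)) +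
      ENNReal.ofReal (inner ℝ p.1 (controlMul R p.1)) := by
  rw [regulatorInf, jointFunctional_of_mem hp, lintegral_runningCost _ _ subset_rfl,
    lintegral_quadratic hR]

/-- Lower semicontinuity of the state cost along pointwise convergent trajectories on growing
horizons. -/
theorem IsNormalIntegrand.lintegral_le_liminf (hℓ : IsNormalIntegrand ℓ₁) {T : ℕ → ℝ}
    (hT0 : ∀ k, 0 < T k) (hT : Tendsto T atTop atTop) {x : ℕ → ℝ → EuclideanSpace ℝ (Fin n)}
    (hx : ∀ k, ContinuousOn (x k) (Icc 0 (T k))) {z : ℝ → EuclideanSpace ℝ (Fin n)}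
    (hxz : ∀ t, 0 ≤ t → Tendsto (fun k => x k t) atTop (𝓝 (z t))) :
    ∫⁻ t in Ioi 0, ℓ₁ t (z t) ≤ liminf (fun k => ∫⁻ t in Ioo 0 (T k), ℓ₁ t (x k t)) atTop := by
  have hmeas : ∀ k, AEMeasurable ((Ioo 0 (T k)).indicator fun t => ℓ₁ t (x k t))
      (volume.restrict (Ioi (0 : ℝ))) := by
    intro k
    -- Outside [0, T k] nothing is known about x k, so measurability is read off its constant
    -- extension.
    have hc : Continuous fun t => x k (projIcc 0 (T k) (hT0 k).le t) :=
      (hx k).domRestrict.comp continuous_projIcc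
    have heq : (Ioo 0 (T k)).indicator (fun t => ℓ₁ t (x k t)) =
        (Ioo 0 (T k)).indicator fun t => ℓ₁ t (x k (projIcc 0 (T k) (hT0 k).le t)) := by
      refine indicator_congr fun t ht => ?_
      rw [projIcc_of_mem _ (Ioo_subset_Icc_self ht)]
    rw [heq]
    exact (hℓ.aemeasurable_comp hc.measurable).indicator measurableSet_Ioo
  calc ∫⁻ t in Ioi 0, ℓ₁ t (z t)
      ≤ ∫⁻ t in Ioi 0, liminf (fun k => (Ioo 0 (T k)).indicator (fun t => ℓ₁ t (x k t)) t)
          atTop := by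
        -- For fixed t the indicator is eventually 1, since T k → ∞; Fatou's lemma then applies on
        -- all of (0,∞).
        refine lintegral_mono_ae ?_
        filter_upwards [hℓ.lowerSemicontinuous, ae_restrict_mem measurableSet_Ioi] with t hlsc ht
        have h1 : ℓ₁ t (z t) ≤ liminf (fun k => ℓ₁ t (x k t)) atTop :=
          (lowerSemicontinuousAt_iff_le_liminf.1 (hlsc (z t))).trans
            (liminf_le_liminf_of_le (u := ℓ₁ t) (hxz t (le_of_lt ht)))
        refine h1.trans (le_of_eq (liminf_congr ?_))
        filter_upwards [hT.eventually_gt_atTop t] with k hk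
        rw [indicator_of_mem (show t ∈ Ioo 0 (T k) from ⟨ht, hk⟩)]
    _ ≤ liminf (fun k => ∫⁻ t in Ioi 0, (Ioo 0 (T k)).indicator (fun t => ℓ₁ t (x k t)) t)
          atTop := lintegral_liminf_le' hmeas
    _ = _ := by
        refine congrArg (fun f => liminf f atTop) (funext fun k => ?_)
        rw [lintegral_indicator measurableSet_Ioo, Measure.restrict_restrict measurableSet_Ioo,
          inter_eq_self_of_subset_left Ioo_subset_Ioi_self]

/-- A priori bound on admissible trajectories of finite cost. -/
theorem IsStorageFunction.le_of_regulatorFin_le {S : EuclideanSpace ℝ (Fin n) → ℝ}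
    (hS : IsStorageFunction a b (runningCost ℓ₁ R) S) {p : Control m × State n}
    (hp : p ∈ admissibleFin a b x₀ T) {V : ℝ≥0∞} (hV : V ≠ ⊤)
    (hpV : regulatorFin a b ℓ₁ R x₀ T p ≤ V) {t : ℝ} (ht : t ∈ Icc 0 T) :
    S (p.2.1 t) ≤ S x₀ + V.toReal := by
  rw [regulatorFin, jointFunctional_of_mem hp] at hpV
  have h1 := hS.dissipation p.1 x₀ p.2.1 t ht.1 (hp.2.1.mono ht.1 ht.2)
  have h2 := h1.trans (EReal.coe_ennreal_le_coe_ennreal_iff.2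
    ((lintegral_mono_set (Ioo_subset_Ioo_right ht.2)).trans hpV))
  rw [← ENNReal.ofReal_toReal hV, EReal.coe_ennreal_ofReal, EReal.coe_le_coe_iff,
    max_eq_left ENNReal.toReal_nonneg] at h2
  linarith

end QuadReg

/-! ### Convergence of optimal controls. -/

theorem mainTheorem4 {n m : ℕ}
    (a : EuclideanSpace ℝ (Fin n) → EuclideanSpace ℝ (Fin n))
    (b : EuclideanSpace ℝ (Fin n) → EuclideanSpace ℝ (Fin m) →L[ℝ] EuclideanSpace ℝ (Fin n))
    (ha : ContDiff ℝ 1 a) (hb : ContDiff ℝ 1 b)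
    (hgrowth : ∃ K : ℝ, 0 ≤ K ∧ ∀ x, ‖a x‖ + ‖b x‖ ≤ K * (1 + ‖x‖))
    (ℓ₁ : ℝ → EuclideanSpace ℝ (Fin n) → ℝ≥0∞) (hℓ₁ : QuadReg.IsNormalIntegrand ℓ₁)
    (R : Matrix (Fin m) (Fin m) ℝ) (hR : R.PosDef)
    (hdiss : ∃ S : EuclideanSpace ℝ (Fin n) → ℝ,
      QuadReg.IsStorageFunction a b (QuadReg.runningCost ℓ₁ R) S ∧ QuadReg.Coercive S)
    (x₀ : EuclideanSpace ℝ (Fin n)) :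
    (∀ p, QuadReg.regulatorInf a b ℓ₁ R x₀ p = ⊤) ∨
    (∀ T : ℕ → ℝ, (∀ k, 0 < T k) → Tendsto T atTop atTop →
      ∀ u : ℕ → QuadReg.Control m,
        (∀ k, QuadReg.IsOptimalControl (QuadReg.regulatorFin a b ℓ₁ R x₀ (T k)) (u k)) →
        ∃ (φ : ℕ → ℕ) (uInf : QuadReg.Control m), StrictMono φ ∧
          QuadReg.IsOptimalControl (QuadReg.regulatorInf a b ℓ₁ R x₀) uInf ∧
          Tendsto (fun k => toWeakSpace ℝ (QuadReg.Control m) (u (φ k))) atTop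
            (𝓝 (toWeakSpace ℝ (QuadReg.Control m) uInf))) := by
  by_cases htop : ∀ p, QuadReg.regulatorInf a b ℓ₁ R x₀ p = ⊤
  · exact Or.inl htop
  refine Or.inr fun T hT0 hT u hu => ?_
  obtain ⟨p₀, hp₀⟩ := not_forall.1 htop
  obtain ⟨S, hS, hScoer⟩ := hdiss
  have hV : ⨅ p, QuadReg.regulatorInf a b ℓ₁ R x₀ p ≠ ⊤ :=
    ((iInf_le _ p₀).trans_lt (lt_top_iff_ne_top.2 hp₀)).ne
  set V := ⨅ p, QuadReg.regulatorInf a b ℓ₁ R x₀ p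
  choose x hx using hu
  have hle : ∀ k, QuadReg.regulatorFin a b ℓ₁ R x₀ (T k) (u k, x k) ≤ V := fun k =>
    (hx k).trans_le (QuadReg.iInf_regulatorFin_le (hT0 k))
  have hadm : ∀ k, (u k, x k) ∈ QuadReg.admissibleFin a b x₀ (T k) := fun k =>
    QuadReg.mem_of_jointFunctional_ne_top ((hle k).trans_lt (lt_top_iff_ne_top.2 hV)).ne
  obtain ⟨c, hc0, hc⟩ := hR.exists_pos_mul_sq_le
  -- From c‖u k‖² ≤ control cost ≤ total cost ≤ V.
  have hC : ∀ k, ‖u k‖ ≤ √(V.toReal / c) := by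
    intro k
    refine Real.le_sqrt_of_sq_le ?_
    rw [le_div_iff₀' hc0]
    refine (QuadReg.mul_sq_norm_le_inner_controlMul hc (u k)).trans ?_
    rw [← ENNReal.ofReal_le_iff_le_toReal hV]
    refine le_trans ?_ (hle k)
    rw [QuadReg.regulatorFin_eq_of_mem hR (hT0 k) (hadm k)]
    exact le_add_self
  obtain ⟨M, hM⟩ := (hScoer (S x₀ + V.toReal)).exists_norm_le
  have hxM : ∀ k, ∀ t ∈ Icc 0 (T k), ‖(x k).1 t‖ ≤ M := fun k t ht =>
    hM _ (hS.le_of_regulatorFin_le (hadm k) hV (hle k) ht)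
  have : Fact ((2 : ℝ≥0∞) ≠ ⊤) := ⟨by simp⟩
  obtain ⟨φ, uInf, hφ, hweak⟩ := exists_subseq_tendsto_inner hC
  obtain ⟨ψ, z, hψ, hxz, hz⟩ := QuadReg.exists_subseq_tendsto_isSolutionOn ha.continuous
    hb.continuous (fun k => hT0 (φ k)) (hT.comp hφ.tendsto_atTop) (fun k => hC (φ k)) hweak
    (fun k => (hadm (φ k)).2.1) (fun k => hxM (φ k))
  have hweak' : ∀ y, Tendsto (fun k => inner ℝ y (u (φ (ψ k)))) atTop (𝓝 (inner ℝ y uInf)) :=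
    fun y => (hweak y).comp hψ.tendsto_atTop
  refine ⟨φ ∘ ψ, uInf, hφ.comp hψ, ⟨⟨z, fun S hS => (hz S hS).absolutelyContinuous⟩, ?_⟩,
    tendsto_toWeakSpace_iff_inner.2 hweak'⟩
  refine le_antisymm ?_ (iInf_le _ _)
  rw [QuadReg.regulatorInf_eq_of_mem hR (fun S hS => hz S hS)]
  have h1 := hℓ₁.lintegral_le_liminf (fun k => hT0 (φ (ψ k)))
    (hT.comp (hφ.comp hψ).tendsto_atTop)
    (fun k => (hadm (φ (ψ k))).2.1.continuousOn (hT0 (φ (ψ k))).le) hxz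
  have h2 := le_of_tendsto_inner_of_quadratic_le (QuadReg.controlMul R)
    (QuadReg.inner_controlMul_nonneg hR) (QuadReg.inner_controlMul_symm hR) hweak'
  have h3 := ENNReal.liminf_add_liminf_le
    (f := fun k => ∫⁻ t in Ioo 0 (T (φ (ψ k))), ℓ₁ t ((x (φ (ψ k))).1 t))
    (g := fun k => ENNReal.ofReal (inner ℝ (u (φ (ψ k))) (QuadReg.controlMul R (u (φ (ψ k))))))
  refine (add_le_add h1 h2).trans (h3.trans ?_)
  -- Every term of the sequence is the cost of an optimal pair, hence at most V, and so is the
  -- liminf.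
  refine liminf_le_of_le (by isBoundedDefault) fun B hB => ?_
  obtain ⟨k, hk⟩ := hB.exists
  refine hk.trans (le_trans (le_of_eq ?_) (hle (φ (ψ k))))
  exact (QuadReg.regulatorFin_eq_of_mem hR (hT0 _) (hadm _)).symm
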